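/- There is a universal constant $C$ with the following property. Let $n\ge 2$ and $k\ge 1$ be integers, let $A$ be a real symmetric $n\times n$ matrix with zero diagonal entries, and let $\pi$ be a probability measure on real $k\times k$ matrices that is centered ($\mathbb{E}_{X\sim\pi}X=0$) and supported on matrices of spectral norm at most $1$. Let $\{\Pi_{ij}\}_{1\le i<j\le n}$ be i.i.d. samples from $\pi$, put $\Pi_{ji}:=\Pi_{ij}^\top$ for $i<j$ and $\Pi_{ii}:=0$, and let $$A^{(k,\pi)}:=\sum_{1\le i,j\le n}A_{ij}\,(E_{ij}\otimes\Pi_{ij}),\qquad E_{ij}:=e_ie_j^\top,$$ be the resulting random symmetric $kn\times kn$ matrix, that is, the entry $A_{ij}$ is replaced by the block $A_{ij}\Pi_{ij}$. Then for every $\epsilon\in(0,1/2]$, $$\mathbb{E}\,\|A^{(k,\pi)}\|\le 2(1+\epsilon)\,\sigma+\frac{C}{\sqrt{\log(1+\epsilon)}}\,\sigma_*\sqrt{\log(kn)},$$ where $\|\cdot\|$ is the spectral norm, $\sigma:=\max_i\sqrt{\sum_j A_{ij}^2}$ and $\sigma_*:=\max_{i,j}|A_{ij}|$. -/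

import Mathlib

open MeasureTheory ProbabilityTheory

/- Matrices carry the `ℓ²` operator (spectral) norm. -/
open scoped Matrix.Norms.L2Operator

/-- The product (equivalently Borel) σ-algebra on real matrices with finitely many entries. -/
instance Matrix.instMeasurableSpaceReal {m n : Type*} : MeasurableSpace (Matrix m n ℝ) :=
  inferInstanceAs (MeasurableSpace (m → n → ℝ))

/-- The index set of pairs `i < j` in `Fin n`. -/
abbrev UpperPair (n : ℕ) : Type := {e : Fin n × Fin n // e.1 < e.2}

/-- The full family of blocks `Π i j` given the blocks above the diagonal:
`Π j i = (Π i j)ᵀ` for `i < j`, and `Π i i = 0`. -/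
def liftBlock {n k : ℕ} (P : UpperPair n → Matrix (Fin k) (Fin k) ℝ) (i j : Fin n) :
    Matrix (Fin k) (Fin k) ℝ :=
  if h : i < j then P ⟨(i, j), h⟩
  else if h : j < i then (P ⟨(j, i), h⟩).transpose
  else 0

/-- The lift `∑ i j, A i j • (E i j ⊗ Π i j)` of `A` with blocks `Π` above the diagonal. -/
noncomputable def matrixLift {n k : ℕ} (A : Matrix (Fin n) (Fin n) ℝ)
    (P : UpperPair n → Matrix (Fin k) (Fin k) ℝ) :
    Matrix (Fin n × Fin k) (Fin n × Fin k) ℝ :=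
  ∑ i, ∑ j, A i j • Matrix.kronecker (Matrix.single i j (1 : ℝ)) (liftBlock P i j)

/-- `σ`: the maximal Euclidean norm of a row. -/
noncomputable def rowSigma {n : ℕ} (A : Matrix (Fin n) (Fin n) ℝ) : ℝ :=
  ⨆ i, √(∑ j, A i j ^ 2)

/-- `σ_*`: the maximal absolute value of an entry. -/
noncomputable def entrySigma {n : ℕ} (A : Matrix (Fin n) (Fin n) ℝ) : ℝ :=
  ⨆ e : Fin n × Fin n, |A e.1 e.2|

namespace Matrix

variable {m n : Type*} [Fintype m] [Fintype n] [DecidableEq n]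

/-- A bound on the squared length of every image bounds the spectral norm. -/
theorem l2_opNorm_le_of_sum_sq_mulVec_le (M : Matrix m n ℝ) {K : ℝ} (hK : 0 ≤ K)
    (h : ∀ v : n → ℝ, ∑ i, (M.mulVec v i) ^ 2 ≤ K ^ 2 * ∑ j, v j ^ 2) : ‖M‖ ≤ K := by
  rw [l2_opNorm_def]
  refine ContinuousLinearMap.opNorm_le_bound _ hK fun x => ?_
  refine (sq_le_sq₀ (by positivity) (by positivity)).mp ?_
  rw [mul_pow, EuclideanSpace.norm_sq_eq, EuclideanSpace.norm_sq_eq]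
  simpa [Real.norm_eq_abs, sq_abs] using h x.ofLp

theorem sum_sq_mulVec_le (M : Matrix m n ℝ) (v : n → ℝ) :
    ∑ i, (M.mulVec v i) ^ 2 ≤ ‖M‖ ^ 2 * ∑ j, v j ^ 2 := by
  have h := M.l2_opNorm_mulVec (WithLp.toLp 2 v)
  have h2 := pow_le_pow_left₀ (norm_nonneg _) h 2
  rw [mul_pow, EuclideanSpace.norm_sq_eq, EuclideanSpace.norm_sq_eq] at h2
  simpa [Real.norm_eq_abs, sq_abs] using h2

theorem abs_apply_le_l2_opNorm (M : Matrix m n ℝ) (i : m) (j : n) : |M i j| ≤ ‖M‖ := by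
  have h := M.sum_sq_mulVec_le (Pi.single j 1)
  have h2 : ∑ j', (Pi.single j (1 : ℝ) : n → ℝ) j' ^ 2 = 1 := by
    rw [Finset.sum_eq_single j] <;> simp +contextual
  rw [h2, mul_one] at h
  simp only [mulVec_single_one, col_apply] at h
  refine abs_le_of_sq_le_sq ((Finset.single_le_sum
    (f := fun i => M i j ^ 2) (fun _ _ => sq_nonneg _) (Finset.mem_univ i)).trans h) (norm_nonneg _)

theorem abs_trace_le_card_mul_l2_opNorm (M : Matrix n n ℝ) :
    |M.trace| ≤ Fintype.card n * ‖M‖ := by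
  rw [trace]
  refine (Finset.abs_sum_le_sum_abs _ _).trans ?_
  refine (Finset.sum_le_sum fun i _ => M.abs_apply_le_l2_opNorm i i).trans ?_
  simp

/-- The spectral norm is at most the Frobenius norm. -/
theorem l2_opNorm_sq_le_sum_sq (M : Matrix m n ℝ) : ‖M‖ ^ 2 ≤ ∑ i, ∑ j, M i j ^ 2 := by
  have h0 : 0 ≤ ∑ i, ∑ j, M i j ^ 2 := by positivity
  have : ‖M‖ ≤ √(∑ i, ∑ j, M i j ^ 2) := by
    refine M.l2_opNorm_le_of_sum_sq_mulVec_le (Real.sqrt_nonneg _) fun v => ?_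
    rw [Real.sq_sqrt h0, Finset.sum_mul]
    exact Finset.sum_le_sum fun i _ => Finset.sum_mul_sq_le_sq_mul_sq _ _ _
  calc ‖M‖ ^ 2 ≤ √(∑ i, ∑ j, M i j ^ 2) ^ 2 := by gcongr
    _ = _ := Real.sq_sqrt h0

theorem l2_opNorm_sq_le_trace (M : Matrix m n ℝ) : ‖M‖ ^ 2 ≤ (Mᵀ * M).trace := by
  refine M.l2_opNorm_sq_le_sum_sq.trans (le_of_eq ?_)
  rw [Finset.sum_comm]
  simp [trace, mul_apply, sq]

/-- If row `i` of `M` has at most `d i` nonzero entries, then `‖M‖ ^ 2` is at most the maximal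
column sum of the numbers `d i * M i j ^ 2`. -/
theorem l2_opNorm_le_of_card_support_le (M : Matrix m n ℝ) {K : ℝ} (hK : 0 ≤ K) (d : m → ℕ)
    (hd : ∀ i, (Finset.univ.filter fun j => M i j ≠ 0).card ≤ d i)
    (h : ∀ j, ∑ i, (d i : ℝ) * M i j ^ 2 ≤ K ^ 2) : ‖M‖ ≤ K := by
  refine M.l2_opNorm_le_of_sum_sq_mulVec_le hK fun v => ?_
  have row : ∀ i, (M.mulVec v i) ^ 2 ≤ ∑ j, (d i : ℝ) * M i j ^ 2 * v j ^ 2 := fun i => by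
    have e : M.mulVec v i = ∑ j ∈ Finset.univ.filter fun j => M i j ≠ 0, M i j * v j := by
      rw [Finset.sum_filter_of_ne]
      · rfl
      · intro j _ hj h0
        simp [h0] at hj
    rw [e]
    refine sq_sum_le_card_mul_sum_sq.trans ?_
    have : ∑ j ∈ Finset.univ.filter (fun j => M i j ≠ 0), (M i j * v j) ^ 2
        ≤ ∑ j, (M i j * v j) ^ 2 :=
      Finset.sum_le_sum_of_subset_of_nonneg (Finset.subset_univ _) fun _ _ _ => sq_nonneg _
    calc _ ≤ (d i : ℝ) * ∑ j, (M i j * v j) ^ 2 := by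
          gcongr
          exact hd i
      _ = _ := by simp only [Finset.mul_sum, mul_pow, mul_assoc]
  refine (Finset.sum_le_sum fun i _ => row i).trans ?_
  rw [Finset.sum_comm, Finset.mul_sum]
  refine Finset.sum_le_sum fun j _ => ?_
  rw [← Finset.sum_mul]
  exact mul_le_mul_of_nonneg_right (h j) (sq_nonneg _)

theorem l2_opNorm_transpose [DecidableEq m] (M : Matrix m n ℝ) : ‖Mᵀ‖ = ‖M‖ := by
  rw [← conjTranspose_eq_transpose_of_trivial, l2_opNorm_conjTranspose]

end Matrix

theorem IsSelfAdjoint.norm_pow_eq {R : Type*} [NormedRing R] [StarRing R] [CStarRing R] {x : R}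
    (hx : IsSelfAdjoint x) {p : ℕ} (hp : 1 ≤ p) : ‖x ^ p‖ = ‖x‖ ^ p := by
  refine le_antisymm (norm_pow_le' x hp) ?_
  rcases eq_or_ne ‖x‖ 0 with h0 | h0
  · rw [h0, zero_pow (by omega)]
    exact norm_nonneg _
  have hlt : p < 2 ^ p := Nat.lt_two_pow_self
  have hpos : 0 < ‖x‖ := lt_of_le_of_ne (norm_nonneg _) h0.symm
  have h1 := hx.norm_pow_two_pow p
  have h2 : ‖x‖ ^ p * ‖x‖ ^ (2 ^ p - p) ≤ ‖x ^ p‖ * ‖x‖ ^ (2 ^ p - p) := by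
    rw [← pow_add, Nat.add_sub_cancel' hlt.le, ← h1]
    conv_lhs => rw [← Nat.add_sub_cancel' hlt.le, pow_add]
    exact (norm_mul_le _ _).trans
      (mul_le_mul_of_nonneg_left (norm_pow_le' x (by omega)) (norm_nonneg _))
  exact le_of_mul_le_mul_right h2 (by positivity)

theorem Matrix.l2_opNorm_pow_le_trace {n : Type*} [Fintype n] [DecidableEq n] {M : Matrix n n ℝ}
    (hM : M.IsSymm) {p : ℕ} (hp : 1 ≤ p) : ‖M‖ ^ (2 * p) ≤ (M ^ (2 * p)).trace := by
  have hs : IsSelfAdjoint M := by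
    rw [IsSelfAdjoint, star_eq_conjTranspose, conjTranspose_eq_transpose_of_trivial]
    exact hM
  have h := (M ^ p).l2_opNorm_sq_le_trace
  rwa [hs.norm_pow_eq hp, ← pow_mul, transpose_pow, hM.eq, ← pow_add, ← two_mul, mul_comm p] at h

/-- Expansion of a power of a sum in a noncommutative ring. -/
theorem Finset.sum_pow_eq_sum_prod_ofFn {ι R : Type*} [Fintype ι] [Semiring R] (f : ι → R) (L : ℕ) :
    (∑ i, f i) ^ L = ∑ w : Fin L → ι, ((List.ofFn w).map f).prod := by
  induction L with
  | zero => simp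
  | succ L ih =>
    rw [pow_succ', ih, ← (Fin.consEquiv fun _ => ι).sum_comp, Fintype.sum_prod_type,
      Finset.sum_mul_sum]
    simp [Fin.consEquiv, List.ofFn_succ]

/-- The block matrix with blocks `B i j • F i j`. -/
noncomputable def blockSum {ι κ : Type*} [Fintype ι] [DecidableEq ι] (B : Matrix ι ι ℝ)
    (F : ι → ι → Matrix κ κ ℝ) : Matrix (ι × κ) (ι × κ) ℝ :=
  ∑ i, ∑ j, B i j • Matrix.kronecker (Matrix.single i j (1 : ℝ)) (F i j)

section blockSum

variable {ι κ : Type*} [Fintype ι] [DecidableEq ι]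

theorem blockSum_apply (B : Matrix ι ι ℝ) (F : ι → ι → Matrix κ κ ℝ) (x y : ι × κ) :
    blockSum B F x y = B x.1 y.1 * F x.1 y.1 x.2 y.2 := by
  rw [blockSum, Matrix.sum_apply, Finset.sum_eq_single x.1, Matrix.sum_apply,
    Finset.sum_eq_single y.1]
  · simp [Matrix.kronecker, Matrix.kroneckerMap_apply]
  · intro j _ hj
    simp [Matrix.kronecker, Matrix.kroneckerMap_apply, hj]
  · simp
  · intro i _ hi
    simp [Matrix.sum_apply, Matrix.kronecker, Matrix.kroneckerMap_apply, hi]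
  · simp

theorem blockSum_eq_sum_prod (B : Matrix ι ι ℝ) (F : ι → ι → Matrix κ κ ℝ) :
    blockSum B F = ∑ d : ι × ι,
      B d.1 d.2 • Matrix.kronecker (Matrix.single d.1 d.2 (1 : ℝ)) (F d.1 d.2) := by
  rw [blockSum, Fintype.sum_prod_type]

variable [Fintype κ] [DecidableEq κ]

theorem prod_map_smul_kronecker (B : Matrix ι ι ℝ) (F : ι → ι → Matrix κ κ ℝ) (l : List (ι × ι)) :
    (l.map fun d => B d.1 d.2 •
      Matrix.kronecker (Matrix.single d.1 d.2 (1 : ℝ)) (F d.1 d.2)).prod =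
    (l.map fun d => B d.1 d.2).prod •
      Matrix.kronecker (l.map fun d => Matrix.single d.1 d.2 (1 : ℝ)).prod
        (l.map fun d => F d.1 d.2).prod := by
  induction l with
  | nil => simp [Matrix.kronecker, Matrix.kroneckerMap_one_one]
  | cons d l ih =>
    simp only [List.map_cons, List.prod_cons, ih]
    rw [Matrix.smul_mul, Matrix.mul_smul, smul_smul]
    congr 1
    exact (Matrix.mul_kronecker_mul _ _ _ _).symm

theorem blockSum_pow (B : Matrix ι ι ℝ) (F : ι → ι → Matrix κ κ ℝ) (L : ℕ) :
    blockSum B F ^ L = ∑ w : Fin L → ι × ι, ((List.ofFn w).map fun d => B d.1 d.2).prod •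
      Matrix.kronecker ((List.ofFn w).map fun d => Matrix.single d.1 d.2 (1 : ℝ)).prod
        ((List.ofFn w).map fun d => F d.1 d.2).prod := by
  rw [blockSum_eq_sum_prod, Finset.sum_pow_eq_sum_prod_ofFn]
  exact Finset.sum_congr rfl fun w _ => prod_map_smul_kronecker B F _

theorem trace_blockSum_pow (B : Matrix ι ι ℝ) (F : ι → ι → Matrix κ κ ℝ) (L : ℕ) :
    (blockSum B F ^ L).trace = ∑ w : Fin L → ι × ι, ((List.ofFn w).map fun d => B d.1 d.2).prod *
      (((List.ofFn w).map fun d => Matrix.single d.1 d.2 (1 : ℝ)).prod.trace *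
        ((List.ofFn w).map fun d => F d.1 d.2).prod.trace) := by
  rw [blockSum_pow, Matrix.trace_sum]
  refine Finset.sum_congr rfl fun w _ => ?_
  rw [Matrix.trace_smul, smul_eq_mul]
  congr 1
  exact Matrix.trace_kronecker _ _

theorem sum_blockSum_pow_apply (B : Matrix ι ι ℝ) (F : ι → ι → Matrix κ κ ℝ) (L : ℕ) (a : κ) :
    ∑ i, (blockSum B F ^ L) (i, a) (i, a) =
      ∑ w : Fin L → ι × ι, ((List.ofFn w).map fun d => B d.1 d.2).prod *
        (((List.ofFn w).map fun d => Matrix.single d.1 d.2 (1 : ℝ)).prod.trace *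
          ((List.ofFn w).map fun d => F d.1 d.2).prod a a) := by
  simp only [blockSum_pow, Matrix.sum_apply]
  rw [Finset.sum_comm]
  refine Finset.sum_congr rfl fun w _ => ?_
  simp [Matrix.kronecker, Matrix.kroneckerMap_apply, Matrix.trace, Finset.mul_sum, Finset.sum_mul]

end blockSum

/-- Sets of at most `N` elements of `E`. -/
abbrev Occupation (E : Type*) (N : ℕ) : Type _ := {S : Finset E // S.card ≤ N}

section ladder

variable {E : Type*} [DecidableEq E] (N : ℕ)

/-- The matrix taking the basis vector of `S` to that of `S ∪ {e}` if `e ∉ S`, and to `0` otherwise. -/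
def creation (e : E) : Matrix (Occupation E N) (Occupation E N) ℝ :=
  Matrix.of fun T S => if e ∉ S.1 ∧ T.1 = insert e S.1 then 1 else 0

/-- The diagonal projection onto the sets containing `e`. -/
def occupancy (e : E) : Matrix (Occupation E N) (Occupation E N) ℝ :=
  Matrix.of fun T S => if e ∈ S.1 ∧ T = S then 1 else 0

/-- The matrix `!![0, 1; 1, 1]` acting on the occupation of `e`. -/
def ladder (e : E) : Matrix (Occupation E N) (Occupation E N) ℝ :=
  creation N e + (creation N e).transpose + occupancy N e

theorem ladder_nonneg (e : E) (S T : Occupation E N) : 0 ≤ ladder N e S T := by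
  simp only [ladder, creation, occupancy, Matrix.add_apply, Matrix.of_apply,
    Matrix.transpose_apply]
  positivity

variable [Fintype E]

theorem prod_ladder_nonneg (l : List E) (S T : Occupation E N) :
    0 ≤ (l.map (ladder N)).prod S T := by
  induction l generalizing S with
  | nil =>
    simp only [List.map_nil, List.prod_nil, Matrix.one_apply]
    positivity
  | cons e l ih =>
    rw [List.map_cons, List.prod_cons, Matrix.mul_apply]
    exact Finset.sum_nonneg fun U _ => mul_nonneg (ladder_nonneg N e S U) (ih U)

/-- Starting from the set of elements of `l` that have been seen in `l₀`, one can read `l` so that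
the state is always the set of elements that have been seen and will be seen again. -/
theorem one_le_prod_ladder_apply (l₀ l : List E) (hN : l₀.length + l.length ≤ N)
    (hl : ∀ e, (l₀ ++ l).count e ≠ 1) (S : Occupation E N)
    (hS : S.1 = l₀.toFinset ∩ l.toFinset) :
    1 ≤ (l.map (ladder N)).prod S ⟨∅, by simp⟩ := by
  induction l generalizing l₀ S with
  | nil =>
    have : S = ⟨∅, by simp⟩ := Subtype.ext (by simpa using hS)
    simp [this]
  | cons e l ih =>
    rw [List.length_cons] at hN
    let U : Occupation E N := ⟨(e :: l₀).toFinset ∩ l.toFinset,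
      ((Finset.card_le_card Finset.inter_subset_left).trans (List.toFinset_card_le _)).trans
        (by simp only [List.length_cons]; omega)⟩
    have hU := ih (e :: l₀) (by simp only [List.length_cons]; omega)
      (fun f => by
        have := hl f
        simp only [List.count_append, List.count_cons] at this ⊢
        omega) U rfl
    have hstep : 1 ≤ ladder N e S U := by
      have ha : ∀ T S, 0 ≤ creation N e T S := fun T S => by
        simp only [creation, Matrix.of_apply]; positivity
      have hz : ∀ T S, 0 ≤ occupancy N e T S := fun T S => by
        simp only [occupancy, Matrix.of_apply]; positivity
      simp only [ladder, Matrix.add_apply, Matrix.transpose_apply]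
      by_cases h0 : e ∈ l₀ <;> by_cases h1 : e ∈ l
      · have : occupancy N e S U = 1 := by
          have hSU : S = U := Subtype.ext (by
            rw [hS]; ext f; by_cases hf : f = e <;> simp [U, hf, h0, h1])
          simp [occupancy, hSU]
          simp [U, h0, h1]
        linarith [ha S U, ha U S]
      · have : creation N e S U = 1 := by
          simp only [creation, Matrix.of_apply]
          refine if_pos ⟨by simp [U, h1], ?_⟩
          rw [hS]; ext f; by_cases hf : f = e <;> simp [U, hf, h0, h1]
        linarith [ha U S, hz S U]
      · have : creation N e U S = 1 := by
          simp only [creation, Matrix.of_apply]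
          refine if_pos ⟨by simp [hS, h0], ?_⟩
          rw [hS]; ext f; by_cases hf : f = e <;> simp [U, hf, h0, h1]
        linarith [ha S U, hz S U]
      · refine absurd ?_ (hl e)
        simp [List.count_append, List.count_eq_zero_of_not_mem h0,
          List.count_eq_zero_of_not_mem h1]
    rw [List.map_cons, List.prod_cons, Matrix.mul_apply]
    refine le_trans ?_ (Finset.single_le_sum (f := fun U => ladder N e S U *
      (l.map (ladder N)).prod U ⟨∅, by simp⟩) (fun V _ => mul_nonneg (ladder_nonneg N e S V)
        (prod_ladder_nonneg N l V _)) (Finset.mem_univ U))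
    exact one_le_mul_of_one_le_of_one_le hstep hU

end ladder

section transfer

variable {V : Type*} [Fintype V] [DecidableEq V]

/-- The number of `j` such that `{i, j}` belongs to `S`. -/
def incidence (S : Finset (Sym2 V)) (i : V) : ℕ := (Finset.univ.filter fun j => s(i, j) ∈ S).card

theorem sum_incidence_le (S : Finset (Sym2 V)) : ∑ i, incidence S i ≤ 2 * S.card := by
  have h : ∑ i, incidence S i = (Finset.univ.filter fun d : V × V => s(d.1, d.2) ∈ S).card := by
    simp only [incidence, Finset.card_filter]
    rw [Fintype.sum_prod_type]
  rw [h]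
  refine Finset.card_le_mul_card_image_of_maps_to (f := fun d : V × V => s(d.1, d.2))
    (fun d hd => by simpa using hd) 2 fun e _ => ?_
  induction e with
  | _ a b =>
    refine (Finset.card_le_card (t := {(a, b), (b, a)}) ?_).trans Finset.card_le_two
    rintro ⟨c, d⟩ hd
    simp at hd
    simp
    tauto

theorem incidence_insert_le (S : Finset (Sym2 V)) (i j : V) :
    incidence (insert s(i, j) S) i ≤ incidence S i + 1 := by
  refine (Finset.card_le_card (t := insert j (Finset.univ.filter fun j => s(i, j) ∈ S)) ?_).trans
    (Finset.card_insert_le _ _)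
  intro c hc
  simp only [Finset.mem_filter, Finset.mem_univ, true_and, Finset.mem_insert,
    Sym2.congr_right] at hc ⊢
  exact hc

variable {N : ℕ} {B : Matrix V V ℝ} {s : ℝ}

theorem sum_incidence_mul_sq_le (hs : ∀ i j, |B i j| ≤ s) (S : Occupation (Sym2 V) N) (j : V) :
    ∑ i, (incidence S.1 i : ℝ) * B i j ^ 2 ≤ 2 * N * s ^ 2 := by
  have h1 : ∀ i, (incidence S.1 i : ℝ) * B i j ^ 2 ≤ incidence S.1 i * s ^ 2 := fun i => by
    gcongr ?_ * ?_
    rw [← sq_abs]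
    have := hs i j
    gcongr
  refine (Finset.sum_le_sum fun i _ => h1 i).trans ?_
  rw [← Finset.sum_mul]
  gcongr
  have h2 := (sum_incidence_le S.1).trans (Nat.mul_le_mul_left 2 S.2)
  exact_mod_cast h2

theorem norm_blockSum_creation_le (hs : ∀ i j, |B i j| ≤ s) {σ : ℝ}
    (hσ : ∀ j, ∑ i, B i j ^ 2 ≤ σ ^ 2) :
    ‖blockSum B fun i j => creation N s(i, j)‖ ≤ √(σ ^ 2 + 2 * N * s ^ 2) := by
  refine Matrix.l2_opNorm_le_of_card_support_le _ (Real.sqrt_nonneg _)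
    (fun x => incidence x.2.1 x.1) (fun x => ?_) fun y => ?_
  · refine Finset.card_le_card_of_injOn (fun y => y.1) (fun y hy => ?_) fun y hy z hz hyz => ?_
    · simp only [blockSum_apply, creation, Matrix.of_apply, Finset.coe_filter,
        Set.mem_ofPred_eq] at hy ⊢
      have h := (ite_ne_right_iff.mp (right_ne_zero_of_mul hy.2)).1.2
      simp [h]
    · simp only [blockSum_apply, creation, Matrix.of_apply, Finset.coe_filter,
        Set.mem_ofPred_eq] at hy hz hyz
      have h := (ite_ne_right_iff.mp (right_ne_zero_of_mul hy.2)).1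
      have h' := (ite_ne_right_iff.mp (right_ne_zero_of_mul hz.2)).1
      refine Prod.ext hyz (Subtype.ext ?_)
      rw [← Finset.erase_insert h.1, ← Finset.erase_insert h'.1, ← h.2, ← h'.2, hyz]
  · obtain ⟨j, S⟩ := y
    rw [Real.sq_sqrt (by positivity), Fintype.sum_prod_type]
    have inner : ∀ i, ∑ T : Occupation (Sym2 V) N, (incidence T.1 i : ℝ) *
        (blockSum B fun i j => creation N s(i, j)) (i, T) (j, S) ^ 2 ≤
        B i j ^ 2 + incidence S.1 i * B i j ^ 2 := fun i => by
      have hR : 0 ≤ B i j ^ 2 + incidence S.1 i * B i j ^ 2 := by positivity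
      by_cases hT : ∃ T : Occupation (Sym2 V) N, s(i, j) ∉ S.1 ∧ T.1 = insert s(i, j) S.1
      · obtain ⟨T, hT⟩ := hT
        rw [Finset.sum_eq_single T]
        · simp only [blockSum_apply, creation, Matrix.of_apply, if_pos hT, mul_one]
          have := incidence_insert_le S.1 i j
          rw [← hT.2] at this
          have : (incidence T.1 i : ℝ) ≤ incidence S.1 i + 1 := by exact_mod_cast this
          nlinarith [sq_nonneg (B i j)]
        · intro T' _ hT'
          simp only [blockSum_apply, creation, Matrix.of_apply]
          rw [if_neg fun h => hT' (Subtype.ext (h.2.trans hT.2.symm))]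
          simp
        · simp
      · rw [Finset.sum_eq_zero]
        · exact hR
        · intro T _
          simp only [blockSum_apply, creation, Matrix.of_apply]
          rw [if_neg fun h => hT ⟨T, h⟩]
          simp
    refine (Finset.sum_le_sum fun i _ => inner i).trans ?_
    rw [Finset.sum_add_distrib]
    exact add_le_add (hσ j) (sum_incidence_mul_sq_le hs S j)

theorem norm_blockSum_occupancy_le (hs : ∀ i j, |B i j| ≤ s) :
    ‖blockSum B fun i j => occupancy N s(i, j)‖ ≤ √(2 * N * s ^ 2) := by
  refine Matrix.l2_opNorm_le_of_card_support_le _ (Real.sqrt_nonneg _)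
    (fun x => incidence x.2.1 x.1) (fun x => ?_) fun y => ?_
  · refine Finset.card_le_card_of_injOn (fun y => y.1) (fun y hy => ?_) fun y hy z hz hyz => ?_
    · simp only [blockSum_apply, occupancy, Matrix.of_apply, Finset.coe_filter,
        Set.mem_ofPred_eq] at hy ⊢
      have h := (ite_ne_right_iff.mp (right_ne_zero_of_mul hy.2)).1
      simpa [h.2] using h.1
    · simp only [blockSum_apply, occupancy, Matrix.of_apply, Finset.coe_filter,
        Set.mem_ofPred_eq] at hy hz hyz
      have h := (ite_ne_right_iff.mp (right_ne_zero_of_mul hy.2)).1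
      have h' := (ite_ne_right_iff.mp (right_ne_zero_of_mul hz.2)).1
      exact Prod.ext hyz (h.2.symm.trans h'.2)
  · obtain ⟨j, S⟩ := y
    rw [Real.sq_sqrt (by positivity), Fintype.sum_prod_type]
    refine le_trans (Finset.sum_le_sum fun i _ => ?_) (sum_incidence_mul_sq_le hs S j)
    rw [Finset.sum_eq_single S]
    · simp only [blockSum_apply, occupancy, Matrix.of_apply, and_true]
      split_ifs
      · simp
      · simp only [mul_zero, ne_eq, OfNat.ofNat_ne_zero, not_false_eq_true, zero_pow]
        positivity
    · intro T _ hT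
      simp [blockSum_apply, occupancy, hT]
    · simp

theorem blockSum_ladder_eq (hB : B.IsSymm) :
    (blockSum B fun i j => ladder N s(i, j)) =
      (blockSum B fun i j => creation N s(i, j)) +
        (blockSum B fun i j => creation N s(i, j)).transpose +
        blockSum B fun i j => occupancy N s(i, j) := by
  ext x y
  simp only [blockSum_apply, Matrix.add_apply, Matrix.transpose_apply, ladder]
  rw [hB.apply, Sym2.eq_swap (a := y.1)]
  ring

theorem norm_blockSum_ladder_le (hB : B.IsSymm) (hs : ∀ i j, |B i j| ≤ s) (hs0 : 0 ≤ s) {σ : ℝ}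
    (hσ0 : 0 ≤ σ) (hσ : ∀ j, ∑ i, B i j ^ 2 ≤ σ ^ 2) :
    ‖blockSum B fun i j => ladder N s(i, j)‖ ≤ 2 * σ + 3 * √(2 * N) * s := by
  have h1 := norm_blockSum_creation_le (N := N) hs hσ
  have h2 := norm_blockSum_occupancy_le (N := N) hs
  have e2 : √(2 * N * s ^ 2) = √(2 * N) * s := by
    rw [Real.sqrt_mul (by positivity), Real.sqrt_sq hs0]
  have h3 : √(σ ^ 2 + 2 * N * s ^ 2) ≤ σ + √(2 * N) * s := by
    refine Real.sqrt_le_iff.mpr ⟨by positivity, ?_⟩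
    have : √(2 * (N : ℝ)) ^ 2 = 2 * N := Real.sq_sqrt (by positivity)
    nlinarith [mul_nonneg hσ0 (mul_nonneg (Real.sqrt_nonneg (2 * (N : ℝ))) hs0)]
  rw [blockSum_ladder_eq hB]
  refine (norm_add_le _ _).trans ?_
  have h4 := norm_add_le (blockSum B fun i j => creation N s(i, j))
    (blockSum B fun i j => creation N s(i, j)).transpose
  rw [Matrix.l2_opNorm_transpose] at h4
  linarith

end transfer

instance Matrix.instBorelSpaceReal {m n : Type*} [Countable m] [Countable n] :
    BorelSpace (Matrix m n ℝ) :=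
  inferInstanceAs (BorelSpace (m → n → ℝ))

instance Matrix.instSecondCountableTopologyReal {m n : Type*} [Countable m] [Countable n] :
    SecondCountableTopology (Matrix m n ℝ) :=
  inferInstanceAs (SecondCountableTopology (m → n → ℝ))

section blocks

variable {n k : ℕ}

theorem matrixLift_eq_blockSum (A : Matrix (Fin n) (Fin n) ℝ)
    (P : UpperPair n → Matrix (Fin k) (Fin k) ℝ) : matrixLift A P = blockSum A (liftBlock P) := rfl

theorem liftBlock_transpose (P : UpperPair n → Matrix (Fin k) (Fin k) ℝ) (i j : Fin n) :
    (liftBlock P i j).transpose = liftBlock P j i := by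
  rcases lt_trichotomy i j with h | rfl | h
  · simp [liftBlock, h, h.not_gt]
  · simp [liftBlock]
  · simp [liftBlock, h, h.not_gt]

theorem matrixLift_isSymm {A : Matrix (Fin n) (Fin n) ℝ} (hA : A.IsSymm)
    (P : UpperPair n → Matrix (Fin k) (Fin k) ℝ) : (matrixLift A P).IsSymm := by
  ext x y
  rw [Matrix.transpose_apply, matrixLift_eq_blockSum, blockSum_apply, blockSum_apply,
    hA.apply, ← liftBlock_transpose P x.1 y.1, Matrix.transpose_apply]

theorem continuous_liftBlock (i j : Fin n) :
    Continuous fun P : UpperPair n → Matrix (Fin k) (Fin k) ℝ => liftBlock P i j := by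
  rcases lt_trichotomy i j with h | rfl | h
  · simpa [liftBlock, h] using continuous_apply _
  · simpa [liftBlock] using continuous_const
  · simpa [liftBlock, h, h.not_gt] using (continuous_apply _).matrix_transpose

theorem continuous_matrixLift (A : Matrix (Fin n) (Fin n) ℝ) :
    Continuous fun P : UpperPair n → Matrix (Fin k) (Fin k) ℝ => matrixLift A P := by
  refine continuous_matrix fun x y => ?_
  simp only [matrixLift_eq_blockSum, blockSum_apply]
  exact continuous_const.mul ((continuous_liftBlock x.1 y.1).matrix_elem x.2 y.2)

/-- The product of the blocks along a list of darts. -/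
noncomputable def blockProd (P : UpperPair n → Matrix (Fin k) (Fin k) ℝ)
    (l : List (Fin n × Fin n)) : Matrix (Fin k) (Fin k) ℝ :=
  (l.map fun d => liftBlock P d.1 d.2).prod

theorem continuous_blockProd (l : List (Fin n × Fin n)) :
    Continuous fun P : UpperPair n → Matrix (Fin k) (Fin k) ℝ => blockProd P l := by
  induction l with
  | nil => simpa [blockProd] using continuous_const
  | cons d l ih =>
    simp only [blockProd, List.map_cons, List.prod_cons] at ih ⊢
    exact (continuous_liftBlock d.1 d.2).matrix_mul ih

theorem norm_liftBlock_le {P : UpperPair n → Matrix (Fin k) (Fin k) ℝ} (hP : ∀ e, ‖P e‖ ≤ 1)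
    (i j : Fin n) : ‖liftBlock P i j‖ ≤ 1 := by
  rcases lt_trichotomy i j with h | rfl | h
  · simpa [liftBlock, h] using hP _
  · simp [liftBlock]
  · simpa [liftBlock, h, h.not_gt, Matrix.l2_opNorm_transpose] using hP _

theorem norm_blockProd_le {P : UpperPair n → Matrix (Fin k) (Fin k) ℝ} (hP : ∀ e, ‖P e‖ ≤ 1)
    (l : List (Fin n × Fin n)) : ‖blockProd P l‖ ≤ 1 := by
  induction l with
  | nil =>
    refine Matrix.l2_opNorm_le_of_sum_sq_mulVec_le _ zero_le_one fun v => ?_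
    simp [blockProd]
  | cons d l ih =>
    simp only [blockProd, List.map_cons, List.prod_cons] at ih ⊢
    exact (norm_mul_le _ _).trans
      (mul_le_one₀ (norm_liftBlock_le hP d.1 d.2) (norm_nonneg _) ih)

theorem liftBlock_update_of_ne (P : UpperPair n → Matrix (Fin k) (Fin k) ℝ) (u : UpperPair n)
    (M : Matrix (Fin k) (Fin k) ℝ) {i j : Fin n} (h : s(i, j) ≠ s(u.1.1, u.1.2)) :
    liftBlock (Function.update P u M) i j = liftBlock P i j := by
  rcases lt_trichotomy i j with hij | rfl | hij
  · have : (⟨(i, j), hij⟩ : UpperPair n) ≠ u := by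
      rintro rfl
      exact h rfl
    simp [liftBlock, hij, Function.update_of_ne this]
  · simp [liftBlock]
  · have : (⟨(j, i), hij⟩ : UpperPair n) ≠ u := by
      rintro rfl
      exact h Sym2.eq_swap
    simp [liftBlock, hij, hij.not_gt, Function.update_of_ne this]

theorem blockProd_update_of_notMem (P : UpperPair n → Matrix (Fin k) (Fin k) ℝ) (u : UpperPair n)
    (M : Matrix (Fin k) (Fin k) ℝ) {l : List (Fin n × Fin n)}
    (h : s(u.1.1, u.1.2) ∉ l.map fun d => s(d.1, d.2)) :
    blockProd (Function.update P u M) l = blockProd P l := by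
  rw [blockProd, blockProd]
  congr 1
  refine List.map_congr_left fun d hd => liftBlock_update_of_ne P u M fun he => h ?_
  exact List.mem_map.mpr ⟨d, hd, he⟩

end blocks

section moments

variable {n k : ℕ} {Ω : Type*} [MeasurableSpace Ω] {μ : Measure Ω}
  {P : UpperPair n → Ω → Matrix (Fin k) (Fin k) ℝ}

theorem integral_liftBlock_apply {π : Measure (Matrix (Fin k) (Fin k) ℝ)}
    (hlaw : ∀ e, HasLaw (P e) π μ) (hc : ∀ a b, ∫ M, M a b ∂π = 0) (i j : Fin n) (a b : Fin k) :
    ∫ ω, liftBlock (fun e => P e ω) i j a b ∂μ = 0 := by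
  have key : ∀ e a b, ∫ ω, P e ω a b ∂μ = 0 := fun e a b => by
    rw [← hc a b, ← (hlaw e).map_eq, integral_map (hlaw e).aemeasurable]
    exact (continuous_id.matrix_elem a b).measurable.aestronglyMeasurable
  rcases lt_trichotomy i j with h | rfl | h
  · simpa [liftBlock, h] using key _ a b
  · simp [liftBlock]
  · simpa [liftBlock, h, h.not_gt] using key _ b a

/-- The block product over the darts other than those along `u` is independent of `P u`. -/
theorem indepFun_blockProd (hm : ∀ e, AEMeasurable (P e) μ) (hi : iIndepFun P μ) (u : UpperPair n)
    {l : List (Fin n × Fin n)} (h : s(u.1.1, u.1.2) ∉ l.map fun d => s(d.1, d.2)) :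
    IndepFun (fun ω => blockProd (fun e => P e ω) l) (P u) μ := by
  have h1 := hi.indepFun_finset₀ (Finset.univ.erase u) {u} (by simp) hm
  let extend : (↥(Finset.univ.erase u) → Matrix (Fin k) (Fin k) ℝ) →
      UpperPair n → Matrix (Fin k) (Fin k) ℝ :=
    fun q e => if he : e ∈ Finset.univ.erase u then q ⟨e, he⟩ else 0
  have hext : Continuous extend := by
    refine continuous_pi fun e => ?_
    by_cases he : e ∈ Finset.univ.erase u
    · simpa only [extend, dif_pos he] using continuous_apply _
    · simpa only [extend, dif_neg he] using continuous_const
  have heval : Measurable fun q : ↥({u} : Finset (UpperPair n)) → Matrix (Fin k) (Fin k) ℝ =>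
      q ⟨u, by simp⟩ := measurable_pi_apply _
  have h2 := h1.comp (φ := fun q => blockProd (extend q) l)
    ((continuous_blockProd l).comp hext).measurable heval
  refine h2.congr (Filter.Eventually.of_forall fun ω => ?_)
    (Filter.Eventually.of_forall fun ω => rfl)
  have : extend (fun i => P i ω) = Function.update (fun e => P e ω) u 0 := by
    funext e
    by_cases he : e = u
    · subst he; simp [extend]
    · simp [extend, he]
  simp only [Function.comp_apply]
  rw [this, blockProd_update_of_notMem _ _ _ h]

variable [IsProbabilityMeasure μ]

theorem integrable_of_continuous_of_bound (hm : ∀ e, AEMeasurable (P e) μ)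
    (hb : ∀ᵐ ω ∂μ, ∀ e, ‖P e ω‖ ≤ 1) {g : (UpperPair n → Matrix (Fin k) (Fin k) ℝ) → ℝ}
    (hg : Continuous g) {K : ℝ} (hK : ∀ Q, (∀ e, ‖Q e‖ ≤ 1) → |g Q| ≤ K) :
    Integrable (fun ω => g fun e => P e ω) μ := by
  refine Integrable.of_bound (C := K)
    (hg.measurable.comp_aemeasurable (aemeasurable_pi_lambda _ hm)).aestronglyMeasurable ?_
  filter_upwards [hb] with ω hω
  exact hK _ hω

/-- A dart whose edge occurs only once makes the expected trace vanish. -/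
theorem integral_trace_blockProd_eq_zero {π : Measure (Matrix (Fin k) (Fin k) ℝ)}
    (hlaw : ∀ e, HasLaw (P e) π μ) (hc : ∀ a b, ∫ M, M a b ∂π = 0)
    (hb : ∀ᵐ ω ∂μ, ∀ e, ‖P e ω‖ ≤ 1) (hi : iIndepFun P μ) {l : List (Fin n × Fin n)}
    (hl : ∀ d ∈ l, d.1 ≠ d.2) {e : Sym2 (Fin n)}
    (he : (l.map fun d => s(d.1, d.2)).count e = 1) :
    ∫ ω, (blockProd (fun e => P e ω) l).trace ∂μ = 0 := by
  have hm := fun e => (hlaw e).aemeasurable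
  obtain ⟨d, hd, hde⟩ := List.mem_map.mp (List.count_pos_iff.mp (he.symm ▸ Nat.one_pos))
  obtain ⟨l₁, l₂, rfl⟩ := List.append_of_mem hd
  obtain ⟨u, hu, hlift⟩ : ∃ u : UpperPair n, s(u.1.1, u.1.2) = s(d.1, d.2) ∧
      ∃ τ : Matrix (Fin k) (Fin k) ℝ → Matrix (Fin k) (Fin k) ℝ, Measurable τ ∧
        ∀ Q, liftBlock Q d.1 d.2 = τ (Q u) := by
    rcases lt_or_gt_of_ne (hl d hd) with h | h
    · exact ⟨⟨(d.1, d.2), h⟩, rfl, id, measurable_id, fun Q => by simp [liftBlock, h]⟩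
    · exact ⟨⟨(d.2, d.1), h⟩, Sym2.eq_swap, Matrix.transpose,
        continuous_id.matrix_transpose.measurable, fun Q => by simp [liftBlock, h, h.not_gt]⟩
  obtain ⟨τ, hτ, hlift⟩ := hlift
  have hnot : s(u.1.1, u.1.2) ∉ (l₂ ++ l₁).map fun d => s(d.1, d.2) := by
    rw [hu, hde, ← List.count_eq_zero]
    simp only [List.map_append, List.map_cons, List.count_append, List.count_cons, hde,
      beq_self_eq_true, if_true] at he ⊢
    omega
  have hind := indepFun_blockProd hm hi u hnot
  have htr : ∀ Q : UpperPair n → Matrix (Fin k) (Fin k) ℝ, (blockProd Q (l₁ ++ d :: l₂)).trace =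
      ∑ a, ∑ b, blockProd Q (l₂ ++ l₁) a b * liftBlock Q d.1 d.2 b a := fun Q => by
    rw [blockProd, List.map_append, List.prod_append, List.map_cons, List.prod_cons,
      Matrix.trace_mul_comm, mul_assoc, Matrix.trace_mul_comm, blockProd, List.map_append,
      List.prod_append]
    simp [Matrix.trace, Matrix.mul_apply]
  simp only [htr]
  have hInt : ∀ a b, Integrable (fun ω => blockProd (fun e => P e ω) (l₂ ++ l₁) a b *
      liftBlock (fun e => P e ω) d.1 d.2 b a) μ := fun a b => by
    refine integrable_of_continuous_of_bound (K := 1) hm hb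
      (((continuous_blockProd _).matrix_elem a b).mul
        ((continuous_liftBlock d.1 d.2).matrix_elem b a)) fun Q hQ => ?_
    rw [Pi.mul_apply, abs_mul]
    exact mul_le_one₀ ((Matrix.abs_apply_le_l2_opNorm _ _ _).trans (norm_blockProd_le hQ _))
      (abs_nonneg _) ((Matrix.abs_apply_le_l2_opNorm _ _ _).trans (norm_liftBlock_le hQ _ _))
  rw [integral_finsetSum _ fun a _ => integrable_finsetSum _ fun b _ => hInt a b]
  refine Finset.sum_eq_zero fun a _ => ?_
  rw [integral_finsetSum _ fun b _ => hInt a b]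
  refine Finset.sum_eq_zero fun b _ => ?_
  have hab := hind.comp (φ := fun M => M a b) (ψ := fun M => τ M b a)
    (continuous_id.matrix_elem a b).measurable ((continuous_id.matrix_elem b a).measurable.comp hτ)
  have hprod := hab.integral_fun_mul_eq_mul_integral
    ((((continuous_blockProd (l₂ ++ l₁)).matrix_elem a b).measurable.comp_aemeasurable
      (aemeasurable_pi_lambda _ hm)).aestronglyMeasurable)
    (((continuous_id.matrix_elem b a).measurable.comp hτ).comp_aemeasurable
      (hm u)).aestronglyMeasurable
  have hz := integral_liftBlock_apply hlaw hc d.1 d.2 b a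
  simp only [hlift] at hz ⊢
  simp only [Function.comp_apply] at hprod
  rw [hprod, hz, mul_zero]

theorem abs_integral_trace_blockProd_le {π : Measure (Matrix (Fin k) (Fin k) ℝ)}
    (hlaw : ∀ e, HasLaw (P e) π μ) (hc : ∀ a b, ∫ M, M a b ∂π = 0)
    (hb : ∀ᵐ ω ∂μ, ∀ e, ‖P e ω‖ ≤ 1) (hi : iIndepFun P μ) {l : List (Fin n × Fin n)}
    (hl : ∀ d ∈ l, d.1 ≠ d.2) {N : ℕ} (hN : l.length ≤ N) :
    |∫ ω, (blockProd (fun e => P e ω) l).trace ∂μ| ≤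
      k * (l.map fun d => ladder N s(d.1, d.2)).prod ⟨∅, by simp⟩ ⟨∅, by simp⟩ := by
  have hmap : (l.map fun d => ladder N s(d.1, d.2)) =
      (l.map fun d => s(d.1, d.2)).map (ladder N) := by simp
  rw [hmap]
  by_cases h : ∃ e, (l.map fun d => s(d.1, d.2)).count e = 1
  · obtain ⟨e, he⟩ := h
    rw [integral_trace_blockProd_eq_zero hlaw hc hb hi hl he, abs_zero]
    exact mul_nonneg (by positivity) (prod_ladder_nonneg N _ _ _)
  · push Not at h
    have h1 := one_le_prod_ladder_apply N [] (l.map fun d => s(d.1, d.2)) (by simpa using hN)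
      (by simpa using h) ⟨∅, by simp⟩ (by simp)
    refine le_trans ?_ (le_mul_of_one_le_right (by positivity) h1)
    have hbd := norm_integral_le_of_norm_le_const (μ := μ)
      (f := fun ω => (blockProd (fun e => P e ω) l).trace) (C := k) (by
        filter_upwards [hb] with ω hω
        have := Matrix.abs_trace_le_card_mul_l2_opNorm (blockProd (fun e => P e ω) l)
        rw [Fintype.card_fin] at this
        exact this.trans (mul_le_of_le_one_right (by positivity) (norm_blockProd_le hω l)))
    simpa using hbd

theorem prod_single_trace_nonneg {ι : Type*} [Fintype ι] [DecidableEq ι] (l : List (ι × ι)) :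
    0 ≤ (l.map fun d => Matrix.single d.1 d.2 (1 : ℝ)).prod.trace := by
  have h : ∀ i j, 0 ≤ (l.map fun d => Matrix.single d.1 d.2 (1 : ℝ)).prod i j := by
    induction l with
    | nil =>
      intro i j
      simp only [List.map_nil, List.prod_nil, Matrix.one_apply]
      positivity
    | cons d l ih =>
      intro i j
      rw [List.map_cons, List.prod_cons, Matrix.mul_apply]
      refine Finset.sum_nonneg fun x _ => mul_nonneg ?_ (ih x j)
      simp only [Matrix.single_apply]
      positivity
  exact Finset.sum_nonneg fun i _ => h i i

theorem integral_trace_matrixLift_pow_le {π : Measure (Matrix (Fin k) (Fin k) ℝ)}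
    (hlaw : ∀ e, HasLaw (P e) π μ) (hc : ∀ a b, ∫ M, M a b ∂π = 0)
    (hb : ∀ᵐ ω ∂μ, ∀ e, ‖P e ω‖ ≤ 1) (hi : iIndepFun P μ) (A : Matrix (Fin n) (Fin n) ℝ)
    (hA : ∀ i, A i i = 0) (L : ℕ) :
    ∫ ω, (matrixLift A (fun e => P e ω) ^ L).trace ∂μ ≤
      k * n * ‖blockSum (A.map fun x => |x|) fun i j => ladder L s(i, j)‖ ^ L := by
  have hm := fun e => (hlaw e).aemeasurable
  have hInt : ∀ l : List (Fin n × Fin n),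
      Integrable (fun ω => (blockProd (fun e => P e ω) l).trace) μ := fun l => by
    refine integrable_of_continuous_of_bound (K := k) hm hb
      (continuous_blockProd l).matrix_trace fun Q hQ => ?_
    have := Matrix.abs_trace_le_card_mul_l2_opNorm (blockProd Q l)
    rw [Fintype.card_fin] at this
    exact this.trans (mul_le_of_le_one_right (by positivity) (norm_blockProd_le hQ l))
  have hexp : ∀ ω, (matrixLift A (fun e => P e ω) ^ L).trace = ∑ w : Fin L → Fin n × Fin n,
      ((List.ofFn w).map fun d => A d.1 d.2).prod *
        (((List.ofFn w).map fun d => Matrix.single d.1 d.2 (1 : ℝ)).prod.trace *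
          (blockProd (fun e => P e ω) (List.ofFn w)).trace) := fun ω => by
    rw [matrixLift_eq_blockSum, trace_blockSum_pow]
    rfl
  simp only [hexp]
  rw [integral_finsetSum _ fun w _ => ((hInt _).const_mul _).const_mul _]
  simp only [integral_const_mul]
  have hbound : ∀ w : Fin L → Fin n × Fin n,
      ((List.ofFn w).map fun d => A d.1 d.2).prod *
        (((List.ofFn w).map fun d => Matrix.single d.1 d.2 (1 : ℝ)).prod.trace *
          ∫ ω, (blockProd (fun e => P e ω) (List.ofFn w)).trace ∂μ) ≤
      k * (((List.ofFn w).map fun d => A.map (fun x => |x|) d.1 d.2).prod *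
        (((List.ofFn w).map fun d => Matrix.single d.1 d.2 (1 : ℝ)).prod.trace *
          ((List.ofFn w).map fun d => ladder L s(d.1, d.2)).prod
            ⟨∅, by simp⟩ ⟨∅, by simp⟩)) := fun w => by
    have habs : ((List.ofFn w).map fun d => A.map (fun x => |x|) d.1 d.2).prod =
        |((List.ofFn w).map fun d => A d.1 d.2).prod| := by
      generalize List.ofFn w = l
      induction l with
      | nil => simp
      | cons d l ih =>
        rw [List.map_cons, List.prod_cons, ih, List.map_cons, List.prod_cons, abs_mul,
          Matrix.map_apply]
    by_cases hl : ∀ d ∈ List.ofFn w, d.1 ≠ d.2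
    · have h1 := abs_integral_trace_blockProd_le hlaw hc hb hi hl (N := L) (by simp)
      have h2 := prod_single_trace_nonneg (List.ofFn w)
      rw [habs]
      refine (le_abs_self _).trans ?_
      rw [abs_mul, abs_mul, abs_of_nonneg h2]
      calc _ ≤ |((List.ofFn w).map fun d => A d.1 d.2).prod| *
            (((List.ofFn w).map fun d => Matrix.single d.1 d.2 (1 : ℝ)).prod.trace *
              (k * ((List.ofFn w).map fun d => ladder L s(d.1, d.2)).prod
                ⟨∅, by simp⟩ ⟨∅, by simp⟩)) := by
            gcongr
        _ = _ := by ring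
    · push Not at hl
      obtain ⟨d, hd, hdd⟩ := hl
      have h0 : ((List.ofFn w).map fun d => A d.1 d.2).prod = 0 :=
        List.prod_eq_zero (List.mem_map.mpr ⟨d, hd, by rw [hdd, hA]⟩)
      rw [habs, h0]
      simp
  refine (Finset.sum_le_sum fun w _ => hbound w).trans ?_
  rw [← Finset.mul_sum, ← sum_blockSum_pow_apply _ (fun i j => ladder L s(i, j)), mul_assoc]
  gcongr
  calc _ ≤ ∑ _i : Fin n, ‖blockSum (A.map fun x => |x|) fun i j => ladder L s(i, j)‖ ^ L := by
        refine Finset.sum_le_sum fun i _ => ?_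
        refine (le_abs_self _).trans ((Matrix.abs_apply_le_l2_opNorm _ _ _).trans ?_)
        rcases Nat.eq_zero_or_pos L with rfl | hL
        · rw [pow_zero, pow_zero]
          refine Matrix.l2_opNorm_le_of_sum_sq_mulVec_le _ zero_le_one fun v => ?_
          simp
        · exact norm_pow_le' _ hL
    _ = _ := by simp

end moments

section sigma

variable {n : ℕ} (A : Matrix (Fin n) (Fin n) ℝ)

theorem rowSigma_nonneg : 0 ≤ rowSigma A := Real.iSup_nonneg fun _ => Real.sqrt_nonneg _

theorem entrySigma_nonneg : 0 ≤ entrySigma A := Real.iSup_nonneg fun _ => abs_nonneg _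

theorem abs_apply_le_entrySigma (i j : Fin n) : |A i j| ≤ entrySigma A :=
  le_ciSup (f := fun e : Fin n × Fin n => |A e.1 e.2|) (Set.finite_range _).bddAbove (i, j)

theorem sum_sq_le_rowSigma_sq (i : Fin n) : ∑ j, A i j ^ 2 ≤ rowSigma A ^ 2 :=
  (Real.sqrt_le_left (rowSigma_nonneg A)).mp
    (le_ciSup (f := fun i => √(∑ j, A i j ^ 2)) (Set.finite_range _).bddAbove i)

end sigma

section expectation

variable {n k : ℕ} {Ω : Type*} [MeasurableSpace Ω] {μ : Measure Ω} [IsProbabilityMeasure μ]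
  {P : UpperPair n → Ω → Matrix (Fin k) (Fin k) ℝ}

theorem norm_matrixLift_le (A : Matrix (Fin n) (Fin n) ℝ)
    {Q : UpperPair n → Matrix (Fin k) (Fin k) ℝ} (hQ : ∀ e, ‖Q e‖ ≤ 1) :
    ‖matrixLift A Q‖ ≤ √(∑ x : Fin n × Fin k, ∑ y : Fin n × Fin k, A x.1 y.1 ^ 2) := by
  refine Real.le_sqrt_of_sq_le ((Matrix.l2_opNorm_sq_le_sum_sq _).trans ?_)
  refine Finset.sum_le_sum fun x _ => Finset.sum_le_sum fun y _ => ?_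
  rw [matrixLift_eq_blockSum, blockSum_apply, mul_pow]
  refine mul_le_of_le_one_right (sq_nonneg _) ?_
  rw [sq_le_one_iff_abs_le_one]
  exact (Matrix.abs_apply_le_l2_opNorm _ _ _).trans (norm_liftBlock_le hQ _ _)

theorem integrable_norm_matrixLift_pow (hm : ∀ e, AEMeasurable (P e) μ)
    (hb : ∀ᵐ ω ∂μ, ∀ e, ‖P e ω‖ ≤ 1) (A : Matrix (Fin n) (Fin n) ℝ) (L : ℕ) :
    Integrable (fun ω => ‖matrixLift A (fun e => P e ω)‖ ^ L) μ :=
  integrable_of_continuous_of_bound hm hb ((continuous_matrixLift A).norm.pow L) fun Q hQ => by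
    rw [Pi.pow_apply, abs_of_nonneg (pow_nonneg (norm_nonneg _) L)]
    exact pow_le_pow_left₀ (norm_nonneg _) (norm_matrixLift_le A hQ) L

theorem integrable_norm_matrixLift (hm : ∀ e, AEMeasurable (P e) μ)
    (hb : ∀ᵐ ω ∂μ, ∀ e, ‖P e ω‖ ≤ 1) (A : Matrix (Fin n) (Fin n) ℝ) :
    Integrable (fun ω => ‖matrixLift A (fun e => P e ω)‖) μ := by
  simpa using integrable_norm_matrixLift_pow hm hb A 1

/-- The moment bound: `(𝔼 ‖X‖) ^ (2 p) ≤ k n (2 σ + 6 √p σ_*) ^ (2 p)`. -/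
theorem integral_norm_matrixLift_pow_le {π : Measure (Matrix (Fin k) (Fin k) ℝ)}
    (hlaw : ∀ e, HasLaw (P e) π μ) (hc : ∀ a b, ∫ M, M a b ∂π = 0)
    (hb : ∀ᵐ ω ∂μ, ∀ e, ‖P e ω‖ ≤ 1) (hi : iIndepFun P μ) {A : Matrix (Fin n) (Fin n) ℝ}
    (hA : A.IsSymm) (hA0 : ∀ i, A i i = 0) {p : ℕ} (hp : 1 ≤ p) :
    (∫ ω, ‖matrixLift A (fun e => P e ω)‖ ∂μ) ^ (2 * p) ≤
      k * n * (2 * rowSigma A + 6 * √p * entrySigma A) ^ (2 * p) := by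
  have hm := fun e => (hlaw e).aemeasurable
  have jensen := (convexOn_pow (𝕜 := ℝ) (2 * p)).map_integral_le (μ := μ)
    (f := fun ω => ‖matrixLift A (fun e => P e ω)‖) (continuous_pow _).continuousOn isClosed_Ici
    (Filter.Eventually.of_forall fun ω => norm_nonneg _) (integrable_norm_matrixLift hm hb A)
    (integrable_norm_matrixLift_pow hm hb A (2 * p))
  refine jensen.trans ?_
  have htr : Integrable (fun ω => (matrixLift A (fun e => P e ω) ^ (2 * p)).trace) μ := by
    refine integrable_of_continuous_of_bound hm hb
      (K := Fintype.card (Fin n × Fin k) *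
        √(∑ x : Fin n × Fin k, ∑ y : Fin n × Fin k, A x.1 y.1 ^ 2) ^ (2 * p))
      ((continuous_matrixLift A).pow (2 * p)).matrix_trace fun Q hQ => ?_
    refine (Matrix.abs_trace_le_card_mul_l2_opNorm _).trans ?_
    gcongr
    exact (norm_pow_le' _ (by omega)).trans
      (pow_le_pow_left₀ (norm_nonneg _) (norm_matrixLift_le A hQ) _)
  refine (integral_mono (integrable_norm_matrixLift_pow hm hb A (2 * p)) htr fun ω =>
    Matrix.l2_opNorm_pow_le_trace (matrixLift_isSymm hA _) hp).trans ?_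
  refine (integral_trace_matrixLift_pow_le hlaw hc hb hi A hA0 (2 * p)).trans ?_
  have hY := norm_blockSum_ladder_le (N := 2 * p) (B := A.map fun x => |x|)
    (s := entrySigma A) (σ := rowSigma A) (by ext i j; simp [hA.apply i j])
    (fun i j => by simpa using abs_apply_le_entrySigma A i j) (entrySigma_nonneg A)
    (rowSigma_nonneg A) (fun j => by
      simpa [sq_abs, hA.apply] using sum_sq_le_rowSigma_sq A j)
  have h4 : √(2 * ((2 * p : ℕ) : ℝ)) = 2 * √p := by
    rw [show (2 * ((2 * p : ℕ) : ℝ)) = 2 ^ 2 * p by push_cast; ring,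
      Real.sqrt_mul (by positivity), Real.sqrt_sq (by norm_num)]
  rw [h4] at hY
  gcongr
  linarith

end expectation

/-- The choice of the moment `p = ⌈log D / (2 log (1 + ε))⌉`. -/
theorem le_of_forall_pow_le {x D σ s ε : ℝ} (hσ : 0 ≤ σ) (hs : 0 ≤ s)
    (hD : 2 ≤ D) (hε : 0 < ε) (hε' : ε ≤ 1 / 2)
    (h : ∀ p : ℕ, 1 ≤ p → x ^ (2 * p) ≤ D * (2 * σ + 6 * √p * s) ^ (2 * p)) :
    x ≤ 2 * (1 + ε) * σ + 18 / √(Real.log (1 + ε)) * s * √(Real.log D) := by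
  have hlam : 0 < Real.log (1 + ε) := Real.log_pos (by linarith)
  have hle : Real.log (1 + ε) ≤ Real.log D := Real.log_le_log (by linarith) (by linarith)
  have hratio : 1 ≤ Real.log D / Real.log (1 + ε) := (one_le_div hlam).mpr hle
  set r := Real.log D / Real.log (1 + ε) with hr
  set p := ⌈r / 2⌉₊ with hpdef
  have hp : 1 ≤ p := Nat.one_le_ceil_iff.mpr (by linarith)
  have hpr : r / 2 ≤ p := Nat.le_ceil _
  have hpr' : (p : ℝ) < r / 2 + 1 := Nat.ceil_lt_add_one (by linarith)
  have hDp : D ≤ (1 + ε) ^ (2 * p) := by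
    rw [← Real.log_le_log_iff (by linarith) (by positivity), Real.log_pow]
    have : Real.log D = r * Real.log (1 + ε) := (div_mul_cancel₀ _ hlam.ne').symm
    rw [this]
    push_cast
    nlinarith
  have hx : x ≤ (1 + ε) * (2 * σ + 6 * √p * s) := by
    refine le_of_pow_le_pow_left₀ (n := 2 * p) (by omega) (by positivity) ?_
    rw [mul_pow]
    refine (h p hp).trans ?_
    gcongr
  have hsq : √(p : ℝ) ≤ 2 * (√(Real.log D) / √(Real.log (1 + ε))) := by
    rw [← Real.sqrt_div (by linarith), ← hr]
    refine Real.sqrt_le_iff.mpr ⟨by positivity, ?_⟩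
    rw [mul_pow, Real.sq_sqrt (by linarith)]
    linarith
  have h1 : (1 + ε) * (6 * √p * s) ≤ 18 / √(Real.log (1 + ε)) * s * √(Real.log D) := by
    calc (1 + ε) * (6 * √p * s) ≤ (3 / 2) *
          (6 * (2 * (√(Real.log D) / √(Real.log (1 + ε)))) * s) := by
          gcongr
          linarith
      _ = _ := by ring
  linarith

theorem mainTheorem1 :
    ∃ C : ℝ, ∀ (n k : ℕ), 2 ≤ n → 1 ≤ k →
      ∀ A : Matrix (Fin n) (Fin n) ℝ, A.IsSymm → (∀ i, A i i = 0) →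
      ∀ (π : Measure (Matrix (Fin k) (Fin k) ℝ)) [IsProbabilityMeasure π],
        (∀ᵐ M ∂π, ‖M‖ ≤ 1) → (∀ a b, ∫ M, M a b ∂π = 0) →
      ∀ (Ω : Type*) [MeasurableSpace Ω] (μ : Measure Ω) [IsProbabilityMeasure μ]
        (P : UpperPair n → Ω → Matrix (Fin k) (Fin k) ℝ),
        (∀ e, HasLaw (P e) π μ) → iIndepFun P μ →
      Integrable (fun ω => ‖matrixLift A (fun e => P e ω)‖) μ ∧
      ∀ ε : ℝ, 0 < ε → ε ≤ 1 / 2 →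
        ∫ ω, ‖matrixLift A (fun e => P e ω)‖ ∂μ ≤
          2 * (1 + ε) * rowSigma A +
            C / √(Real.log (1 + ε)) * entrySigma A * √(Real.log ((k : ℝ) * n)) := by
  refine ⟨18, fun n k hn hk A hA hA0 π _ hπ hc Ω _ μ _ P hlaw hi => ?_⟩
  have hb : ∀ᵐ ω ∂μ, ∀ e, ‖P e ω‖ ≤ 1 := by
    refine ae_all_iff.mpr fun e => ?_
    rw [← (hlaw e).map_eq] at hπ
    exact ae_of_ae_map (hlaw e).aemeasurable hπ
  have hD : (2 : ℝ) ≤ k * n := by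
    have : 2 ≤ k * n := by nlinarith
    exact_mod_cast this
  exact ⟨integrable_norm_matrixLift (fun e => (hlaw e).aemeasurable) hb A, fun ε hε hε' =>
    le_of_forall_pow_le (rowSigma_nonneg A) (entrySigma_nonneg A) hD hε hε' fun p hp =>
      integral_norm_matrixLift_pow_le hlaw hc hb hi hA hA0 hp⟩
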